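/- Let $\mathcal X\subset\mathbb R^d$ be compact. Let $\{\zeta_i\}_{i\ge 1}$ be the points of a Poisson process on $(0,\infty)$ with intensity measure $\zeta^{-2}\,d\zeta$ and let $Y_1,Y_2,\dots$, independent of $\{\zeta_i\}_{i\ge1}$, be independent copies of a non-negative stochastic process $Y$ on $\mathcal X$ with continuous sample paths such that $\mathbb E\,Y(s)=1$ for all $s\in\mathcal X$ and $\mathbb E\sup_{s\in\mathcal X}Y(s)<\infty$. Put $\varphi_i(s)=\zeta_iY_i(s)$ and consider the max-stable process $$\eta(s)=\max_{i\ge1}\varphi_i(s),\qquad s\in\mathcal X.$$ For $s_1,s_2\in\mathcal X$ define the extremal concurrence probability $$p(s_1,s_2)=\mathbb P\{\text{there is } \ell\ge1 \text{ such that } \eta(s_1)=\varphi_\ell(s_1)\text{ and }\eta(s_2)=\varphi_\ell(s_2)\}.$$ Then for all $s_1,s_2\in\mathcal X$: (i) $p(s_1,s_2)=0$ if and only if $\eta(s_1)$ and $\eta(s_2)$ are independent; (ii) $p(s_1,s_2)=1$ if and only if $\eta(s_1)=\eta(s_2)$ almost surely. -/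

import Mathlib

open MeasureTheory ProbabilityTheory Set
open scoped ENNReal NNReal

noncomputable section

namespace MaxStable

/-- The Poisson distribution with parameter `r ∈ [0, ∞]`, as a law on `{0, 1, 2, …, ∞}`;
for `r = ∞` it is the point mass at `∞`. -/
def poissonLaw (r : ℝ≥0∞) : Measure ℕ∞ :=
  if r = ∞ then Measure.dirac ⊤
  else (poissonMeasure r.toNNReal).map (fun n : ℕ => (n : ℕ∞))

/-- The number of points (counted with multiplicity) of the random sequence `ξ` in `B`. -/
def pointCount {Ω E : Type*} (ξ : ℕ → Ω → E) (B : Set E) (ω : Ω) : ℕ∞ :=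
  {i : ℕ | ξ i ω ∈ B}.encard

/-- The random points `ξ 0, ξ 1, …` are the points, enumerated in some measurable way, of a
Poisson process with intensity measure `Λ`: the number of points in `B` has the Poisson
distribution with parameter `Λ B`, and the numbers of points in disjoint sets are independent. -/
structure IsPoissonProcess {Ω E : Type*} [MeasurableSpace Ω] [MeasurableSpace E]
    (ξ : ℕ → Ω → E) (Λ : Measure E) (P : Measure Ω) : Prop where
  measurable : ∀ i, Measurable (ξ i)
  map_pointCount : ∀ B : Set E, MeasurableSet B → P.map (pointCount ξ B) = poissonLaw (Λ B)
  iIndepFun_pointCount : ∀ (n : ℕ) (B : Fin n → Set E), (∀ j, MeasurableSet (B j)) →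
    Pairwise (fun i j => Disjoint (B i) (B j)) → iIndepFun (fun j => pointCount ξ (B j)) P

/-- The measure `ζ⁻² dζ` on `(0, ∞)`, as a measure on `ℝ`. -/
def frechetIntensity : Measure ℝ :=
  (volume.restrict (Ioi 0)).withDensity (fun z => ENNReal.ofReal (z ^ 2)⁻¹)

/-- `Y` is a non-negative stochastic process with continuous sample paths, with
`E Y(s) = 1` for all `s` and `E sup_s Y(s) < ∞`. (Since the Bochner integral of a
non-integrable function is `0`, the condition `mean_one` contains integrability.) -/
structure IsSpectralProcess {Ω T : Type*} [MeasurableSpace Ω] [TopologicalSpace T]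
    (Y : T → Ω → ℝ) (P : Measure Ω) : Prop where
  measurable : ∀ s, Measurable (Y s)
  nonneg : ∀ s ω, 0 ≤ Y s ω
  continuous_paths : ∀ ω, Continuous (fun s => Y s ω)
  mean_one : ∀ s, ∫ ω, Y s ω ∂P = 1
  lintegral_sup_lt_top : ∫⁻ ω, ⨆ s, ENNReal.ofReal (Y s ω) ∂P < ∞

/-- The data of a spectral representation: `ζ 0, ζ 1, …` are the points of a Poisson process on
`(0, ∞)` with intensity `ζ⁻² dζ`, and `Y 0, Y 1, …` are independent copies of a process as in
`IsSpectralProcess`, independent of the sequence `ζ`. -/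
structure IsSpectralData {Ω T : Type*} [MeasurableSpace Ω] [TopologicalSpace T]
    (ζ : ℕ → Ω → ℝ) (Y : ℕ → T → Ω → ℝ) (P : Measure Ω) : Prop where
  poisson : IsPoissonProcess ζ frechetIntensity P
  spectral : ∀ i, IsSpectralProcess (Y i) P
  iIndep : iIndepFun (fun i ω s => Y i s ω) P
  identDistrib : ∀ i, IdentDistrib (fun ω s => Y i s ω) (fun ω s => Y 0 s ω) P P
  indep : IndepFun (fun ω i => ζ i ω) (fun ω i s => Y i s ω) P

/-- The functions `φ_i(s) = ζ_i Y_i(s)`. -/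
def phi {Ω T : Type*} (ζ : ℕ → Ω → ℝ) (Y : ℕ → T → Ω → ℝ) (i : ℕ) (s : T) (ω : Ω) : ℝ :=
  ζ i ω * Y i s ω

/-- The max-stable process `η(s) = max_i ζ_i Y_i(s)` (almost surely, for each `s`, the family is
bounded and its supremum is attained). -/
def eta {Ω T : Type*} (ζ : ℕ → Ω → ℝ) (Y : ℕ → T → Ω → ℝ) (s : T) (ω : Ω) : ℝ :=
  ⨆ i, phi ζ Y i s ω

/-- The extremal concurrence probability
`p(s_1, …, s_k) = P{for some ℓ, η(s_j) = φ_ℓ(s_j) for all j}`. -/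
def concurrenceProb {Ω T : Type*} [MeasurableSpace Ω] (P : Measure Ω)
    (ζ : ℕ → Ω → ℝ) (Y : ℕ → T → Ω → ℝ) {k : ℕ} (s : Fin k → T) : ℝ :=
  P.real {ω | ∃ l : ℕ, ∀ j, eta ζ Y (s j) ω = phi ζ Y l (s j) ω}

end MaxStable

end

/-! The pairs (ζ_i, Y_i) behave like a Poisson process with intensity μ = ζ⁻² dζ ⊗ law(Y). All that
is used of this is the Laplace functional E exp(-∑ f) = exp(-∫ (1 - e^{-f}) dμ), recorded as
`HasPoissonLaplace`. Let A and B be the sets of pairs (z, y) with z y(s₁) > 1 and z y(s₂) > 1. Both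
have μ-mass 1, and η(s₁) ≤ 1 means almost surely that A contains no point.

(i) Both sides are equivalent to Y(s₁) Y(s₂) = 0 a.s. Independence at level (1, 1) compares void
probabilities and gives μ(A ∩ B) = 0. So does p = 0: otherwise, with positive probability, exactly
one point lies in A ∩ B and none in the symmetric difference, and that point attains both maxima.
Integrating out ζ turns μ(A ∩ B) = 0 into Y(s₁) Y(s₂) = 0. Conversely, the exceedance sets at all
positive levels are then disjoint up to null sets, so joint distribution functions factor; and no
point attains both maxima, since these are positive.

(ii) Both sides are equivalent to Y(s₁) = Y(s₂) a.s. If p = 1 and A ∩ B is void, then A \ B or B \ A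
is void. With t = exp(-μ(A \ B)) = exp(-μ(B \ A)), inclusion–exclusion gives 1 + t² ≤ 2t, so t = 1
(`measure_diff_eq_zero_of_concurrence`). If the maxima agree a.s., then A ∪ B and B have equal void
probabilities, and again the differences are null. -/

noncomputable section

namespace MaxStable

open Filter Topology

/-! ### The exponential on [0, ∞] and the Laplace transform of the Poisson law -/

/-- The function `a ↦ exp (-a)` on `[0, ∞]`. -/
def expNeg (a : ℝ≥0∞) : ℝ≥0∞ := (-(a : EReal)).exp

lemma expNeg_ofReal {x : ℝ} (hx : 0 ≤ x) :
    expNeg (ENNReal.ofReal x) = ENNReal.ofReal (Real.exp (-x)) := by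
  rw [expNeg, EReal.coe_ennreal_ofReal, max_eq_left hx, ← EReal.coe_neg, EReal.exp_coe]

@[simp] lemma expNeg_zero : expNeg 0 = 1 := by simp [expNeg]

@[simp] lemma expNeg_top : expNeg ∞ = 0 := by simp [expNeg]

lemma expNeg_strictAnti : StrictAnti expNeg := fun a b h => by
  simpa [expNeg] using h

lemma expNeg_antitone : Antitone expNeg := expNeg_strictAnti.antitone

lemma expNeg_injective : Function.Injective expNeg := expNeg_strictAnti.injective

lemma expNeg_le_one (a : ℝ≥0∞) : expNeg a ≤ 1 := by
  simpa using expNeg_antitone (bot_le : 0 ≤ a)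

lemma expNeg_ne_top (a : ℝ≥0∞) : expNeg a ≠ ∞ :=
  ((expNeg_le_one a).trans_lt ENNReal.one_lt_top).ne

lemma expNeg_eq_zero {a : ℝ≥0∞} : expNeg a = 0 ↔ a = ∞ := by
  rw [← expNeg_top, expNeg_injective.eq_iff]

lemma expNeg_eq_one {a : ℝ≥0∞} : expNeg a = 1 ↔ a = 0 := by
  rw [← expNeg_zero, expNeg_injective.eq_iff]

lemma expNeg_add (a b : ℝ≥0∞) : expNeg (a + b) = expNeg a * expNeg b := by
  induction a with
  | top => simp
  | coe a =>
    induction b with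
    | top => simp
    | coe b =>
      rw [← ENNReal.coe_add]
      simp only [← ENNReal.ofReal_coe_nnreal]
      rw [expNeg_ofReal (by positivity), expNeg_ofReal (by positivity),
        expNeg_ofReal (by positivity), ← ENNReal.ofReal_mul (by positivity), ← Real.exp_add]
      congr 2
      push_cast
      ring

lemma expNeg_sum {ι : Type*} (s : Finset ι) (f : ι → ℝ≥0∞) :
    expNeg (∑ i ∈ s, f i) = ∏ i ∈ s, expNeg (f i) := by
  classical
  induction s using Finset.induction_on with
  | empty => simp
  | insert a s ha ih => rw [Finset.sum_insert ha, Finset.prod_insert ha, expNeg_add, ih]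

lemma expNeg_mul_natCast (a : ℝ≥0∞) (n : ℕ) : expNeg (a * n) = expNeg a ^ n := by
  induction n with
  | zero => simp
  | succ n ih => rw [Nat.cast_succ, mul_add, mul_one, expNeg_add, ih, pow_succ]

lemma continuous_expNeg : Continuous expNeg :=
  ENNReal.continuous_exp.comp (continuous_neg.comp continuous_coe_ennreal_ereal)

lemma measurable_expNeg : Measurable expNeg := continuous_expNeg.measurable

lemma exists_expNeg_eq {t : ℝ≥0∞} (ht : t ≤ 1) : expNeg (-t.log).toENNReal = t := by
  rw [expNeg, EReal.coe_toENNReal (by simpa using ht), neg_neg, ENNReal.exp_log]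

lemma lintegral_poissonLaw {c r : ℝ≥0∞} :
    ∫⁻ n : ℕ∞, expNeg (c * (n : ℝ≥0∞)) ∂(poissonLaw r) = expNeg ((1 - expNeg c) * r) := by
  rw [poissonLaw]
  split_ifs with hr
  · subst hr
    rw [lintegral_dirac]
    rcases eq_or_ne c 0 with rfl | hc
    · simp
    · have : 1 - expNeg c ≠ 0 := by
        intro h0
        have h1 : 1 ≤ expNeg c := tsub_eq_zero_iff_le.1 h0
        exact hc (expNeg_eq_one.1 (le_antisymm (expNeg_le_one c) h1))
      simp [ENNReal.mul_top hc, ENNReal.mul_top this]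
  · lift r to ℝ≥0 using hr
    rw [lintegral_map .of_discrete .of_discrete]
    simp only [ENNReal.toNNReal_coe, ENat.toENNReal_coe, expNeg_mul_natCast]
    have ht := expNeg_le_one c
    generalize expNeg c = t at ht
    lift t to ℝ≥0 using (ht.trans_lt ENNReal.one_lt_top).ne
    have ht' : (t : ℝ) ≤ 1 := by exact_mod_cast ht
    rw [poissonMeasure, lintegral_sum_measure]
    simp only [lintegral_smul_measure, lintegral_dirac, smul_eq_mul]
    have h1 : ∀ n : ℕ, ENNReal.ofReal (Real.exp (-r) * r ^ n / (n.factorial)) * (t : ℝ≥0∞) ^ n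
        = ENNReal.ofReal (Real.exp (-r) * ((r * t) ^ n / n.factorial)) := by
      intro n
      rw [← ENNReal.ofReal_coe_nnreal (p := t), ← ENNReal.ofReal_pow (by positivity),
        ← ENNReal.ofReal_mul (by positivity)]
      congr 1
      ring
    simp only [h1]
    have hs := (NormedSpace.expSeries_div_hasSum_exp ((r : ℝ) * t)).mul_left (Real.exp (-r))
    rw [← ENNReal.ofReal_tsum_of_nonneg (fun n => by positivity) hs.summable, hs.tsum_eq,
      ← Real.exp_eq_exp_ℝ, ← Real.exp_add]
    have h2 : (1 - (t : ℝ≥0∞)) * r = ENNReal.ofReal ((1 - t) * r) := by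
      rw [ENNReal.ofReal_mul (by linarith), ENNReal.ofReal_sub _ (by positivity)]
      simp
    rw [h2, expNeg_ofReal (mul_nonneg (by linarith) (by positivity))]
    congr 2
    ring

/-! ### The Laplace functional of a Poisson process -/

/-- The counting measure of the points `ξ 0 ω, ξ 1 ω, …`. -/
def countingMeasure {Ω E : Type*} [MeasurableSpace E] (ξ : ℕ → Ω → E) (ω : Ω) : Measure E :=
  Measure.sum fun i => Measure.dirac (ξ i ω)

lemma tsum_indicator_one_eq_pointCount {Ω E : Type*} {ξ : ℕ → Ω → E} (B : Set E) (ω : Ω) :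
    ∑' i, B.indicator 1 (ξ i ω) = (pointCount ξ B ω : ℝ≥0∞) := by
  rw [pointCount, ← ENNReal.tsum_set_one, tsum_subtype _ fun _ => (1 : ℝ≥0∞)]
  rfl

section
variable {Ω E : Type*} [MeasurableSpace E] {ξ : ℕ → Ω → E}

lemma lintegral_countingMeasure {f : E → ℝ≥0∞} (hf : Measurable f) (ω : Ω) :
    ∫⁻ x, f x ∂(countingMeasure ξ ω) = ∑' i, f (ξ i ω) := by
  rw [countingMeasure, lintegral_sum_measure]
  simp only [lintegral_dirac' _ hf]

lemma countingMeasure_apply {B : Set E} (hB : MeasurableSet B) (ω : Ω) :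
    countingMeasure ξ ω B = (pointCount ξ B ω : ℝ≥0∞) := by
  rw [← tsum_indicator_one_eq_pointCount, countingMeasure, Measure.sum_apply _ hB]
  simp only [Measure.dirac_apply' _ hB]

variable [MeasurableSpace Ω] {P : Measure Ω} {Λ : Measure E}

lemma measurable_toENNReal_pointCount (hξ : ∀ i, Measurable (ξ i)) {B : Set E}
    (hB : MeasurableSet B) : Measurable fun ω => (pointCount ξ B ω : ℝ≥0∞) := by
  simp only [← tsum_indicator_one_eq_pointCount]
  exact Measurable.tsum fun i => (measurable_one.indicator hB).comp (hξ i)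

lemma measurable_pointCount (hξ : ∀ i, Measurable (ξ i)) {B : Set E}
    (hB : MeasurableSet B) : Measurable (pointCount ξ B) := by
  refine measurable_to_countable' fun n => ?_
  have := measurable_toENNReal_pointCount hξ hB (measurableSet_singleton (n : ℝ≥0∞))
  convert this using 1
  ext ω
  simp

/-- Grouping the points by the value of `f` turns the sum into a combination of the counts of the
fibres, which are independent Poisson variables. -/
lemma IsPoissonProcess.lintegral_expNeg_simpleFunc (h : IsPoissonProcess ξ Λ P)
    (f : SimpleFunc E ℝ≥0∞) :
    ∫⁻ ω, expNeg (∑' i, f (ξ i ω)) ∂P = expNeg (∫⁻ x, (1 - expNeg (f x)) ∂Λ) := by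
  have hm : ∀ c, MeasurableSet (f ⁻¹' {c}) := fun c => f.measurableSet_fiber c
  have h1 : ∀ ω, expNeg (∑' i, f (ξ i ω))
      = ∏ c ∈ f.range, expNeg (c * (pointCount ξ (f ⁻¹' {c}) ω : ℝ≥0∞)) := by
    intro ω
    rw [← lintegral_countingMeasure f.measurable, SimpleFunc.lintegral_eq_lintegral,
      SimpleFunc.lintegral, expNeg_sum]
    simp only [countingMeasure_apply (hm _)]
  have h2 : ∫⁻ x, (1 - expNeg (f x)) ∂Λ
      = ∑ c ∈ f.range, (1 - expNeg c) * Λ (f ⁻¹' {c}) := by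
    rw [← SimpleFunc.map_lintegral (fun c => 1 - expNeg c) f, ← SimpleFunc.lintegral_eq_lintegral]
    rfl
  have hind : iIndepFun (fun c : f.range => pointCount ξ (f ⁻¹' {c.1})) P := by
    have := h.iIndepFun_pointCount f.range.card (fun j => f ⁻¹' {(f.range.equivFin.symm j).1})
      (fun j => hm _) (fun i j hij => by
        refine Disjoint.preimage _ ?_
        rw [disjoint_singleton]
        exact fun hh => hij (f.range.equivFin.symm.injective (Subtype.ext hh)))
    have := this.precomp f.range.equivFin.injective
    simpa [Function.comp_def] using this
  have hind2 := hind.comp (fun c n => expNeg (c.1 * (n : ℝ≥0∞))) (fun c => .of_discrete)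
  have hmeas : ∀ c : ℝ≥0∞, Measurable fun ω => expNeg (c * (pointCount ξ (f ⁻¹' {c}) ω : ℝ≥0∞)) :=
    fun c => measurable_expNeg.comp
      ((measurable_toENNReal_pointCount h.measurable (hm c)).const_mul c)
  simp only [h1, h2, expNeg_sum]
  simp only [← Finset.prod_coe_sort f.range]
  have h3 := lintegral_prod_eq_prod_lintegral_of_indepFun Finset.univ _ hind2
    (fun c => hmeas c.1)
  simp only [Function.comp_def] at h3
  rw [h3]
  refine Finset.prod_congr rfl fun c _ => ?_
  rw [← lintegral_poissonLaw, ← h.map_pointCount _ (hm _),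
    lintegral_map .of_discrete (measurable_pointCount h.measurable (hm _))]

/-- The Laplace functional of a Poisson process. -/
theorem IsPoissonProcess.lintegral_expNeg [IsProbabilityMeasure P] (h : IsPoissonProcess ξ Λ P)
    {f : E → ℝ≥0∞} (hf : Measurable f) :
    ∫⁻ ω, expNeg (∑' i, f (ξ i ω)) ∂P = expNeg (∫⁻ x, (1 - expNeg (f x)) ∂Λ) := by
  -- Approximation by simple functions from below: monotone convergence for the sum over points and
  -- for the exponent, dominated convergence for the expectation.
  have hlim : ∀ x, Tendsto (fun k => SimpleFunc.eapprox f k x) atTop (𝓝 (f x)) :=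
    fun x => SimpleFunc.tendsto_eapprox hf x
  have hmono : ∀ x, Monotone (fun k => SimpleFunc.eapprox f k x) :=
    fun x => fun i j hij => SimpleFunc.monotone_eapprox f hij x
  have h1 : ∀ ω, Tendsto (fun k => ∑' i, SimpleFunc.eapprox f k (ξ i ω)) atTop
      (𝓝 (∑' i, f (ξ i ω))) := by
    intro ω
    simp only [← lintegral_countingMeasure hf,
      ← lintegral_countingMeasure (SimpleFunc.measurable _)]
    exact lintegral_tendsto_of_tendsto_of_monotone (fun k => (SimpleFunc.measurable _).aemeasurable)
      (ae_of_all _ hmono) (ae_of_all _ hlim)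
  have h2 : Tendsto (fun k => ∫⁻ ω, expNeg (∑' i, SimpleFunc.eapprox f k (ξ i ω)) ∂P) atTop
      (𝓝 (∫⁻ ω, expNeg (∑' i, f (ξ i ω)) ∂P)) := by
    refine tendsto_lintegral_of_dominated_convergence (fun _ => 1) (fun k => ?_)
      (fun k => ae_of_all _ fun ω => expNeg_le_one _) (by simp)
      (ae_of_all _ fun ω => (continuous_expNeg.tendsto _).comp (h1 ω))
    exact measurable_expNeg.comp (Measurable.tsum fun i =>
      (SimpleFunc.measurable _).comp (h.measurable i))
  have h3 : Tendsto (fun k => ∫⁻ x, (1 - expNeg (SimpleFunc.eapprox f k x)) ∂Λ) atTop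
      (𝓝 (∫⁻ x, (1 - expNeg (f x)) ∂Λ)) := by
    refine lintegral_tendsto_of_tendsto_of_monotone (fun k => ?_) (ae_of_all _ fun x i j hij => ?_)
      (ae_of_all _ fun x => ?_)
    · exact (measurable_const.sub
        (measurable_expNeg.comp (SimpleFunc.measurable _))).aemeasurable
    · exact tsub_le_tsub_left (expNeg_antitone (hmono x hij)) _
    · exact ENNReal.Tendsto.sub tendsto_const_nhds ((continuous_expNeg.tendsto _).comp (hlim x))
        (Or.inl ENNReal.one_ne_top)
  refine tendsto_nhds_unique h2 ?_
  simp only [h.lintegral_expNeg_simpleFunc]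
  exact (continuous_expNeg.tendsto _).comp h3

end

/-! ### Independent marking -/

section
variable {Ω E F : Type*} [MeasurableSpace Ω] [MeasurableSpace E] [MeasurableSpace F]
  {P : Measure Ω} [IsProbabilityMeasure P]

lemma tendsto_lintegral_expNeg_sum {f : ℕ → Ω → ℝ≥0∞} (hf : ∀ i, Measurable (f i)) :
    Tendsto (fun n => ∫⁻ ω, expNeg (∑ i ∈ Finset.range n, f i ω) ∂P) atTop
      (𝓝 (∫⁻ ω, expNeg (∑' i, f i ω) ∂P)) := by
  refine tendsto_lintegral_of_dominated_convergence (fun _ => 1) (fun n => ?_)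
      (fun k => ae_of_all _ fun ω => expNeg_le_one _) (by simp)
      (ae_of_all _ fun ω => (continuous_expNeg.tendsto _).comp
        ENNReal.summable.hasSum.tendsto_sum_nat)
  exact measurable_expNeg.comp (Finset.measurable_sum _ fun i _ => hf i)

/-- The Laplace functional of an independently marked Poisson process. -/
theorem IsPoissonProcess.lintegral_expNeg_marked {ξ : ℕ → Ω → E} {Λ : Measure E}
    (h : IsPoissonProcess ξ Λ P) {W : ℕ → Ω → F} {ν : Measure F} [IsProbabilityMeasure ν]
    (hW : ∀ i, Measurable (W i)) (hν : ∀ i, P.map (W i) = ν) (hWi : iIndepFun W P)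
    (hξW : IndepFun (fun ω i => ξ i ω) (fun ω i => W i ω) P)
    {f : E × F → ℝ≥0∞} (hf : Measurable f) :
    ∫⁻ ω, expNeg (∑' i, f (ξ i ω, W i ω)) ∂P
      = expNeg (∫⁻ x, (1 - ∫⁻ w, expNeg (f (x, w)) ∂ν) ∂Λ) := by
  have hef : Measurable fun p : E × F => expNeg (f p) := measurable_expNeg.comp hf
  set g : E → ℝ≥0∞ := fun x => ∫⁻ w, expNeg (f (x, w)) ∂ν with hg
  have hgm : Measurable g := hef.lintegral_prod_right'
  have hg1 : ∀ x, g x ≤ 1 := fun x => by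
    calc g x ≤ ∫⁻ _, 1 ∂ν := lintegral_mono fun w => expNeg_le_one _
      _ = 1 := by simp
  -- Averaging over the marks replaces e^{-f} by `g`, so the marked functional at `f` equals the
  -- unmarked one at -log `g`. This is checked for finitely many points, then passed to the limit.
  set φ : E → ℝ≥0∞ := fun x => (-(g x).log).toENNReal with hφ
  have hφm : Measurable φ := hgm.ennreal_log.neg.ereal_toENNReal
  have hφg : ∀ x, expNeg (φ x) = g x := fun x => exists_expNeg_eq (hg1 x)
  have hξm : Measurable fun ω i => ξ i ω := measurable_pi_lambda _ h.measurable
  have hWm : Measurable fun ω i => W i ω := measurable_pi_lambda _ hW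
  have key : ∀ n, ∫⁻ ω, expNeg (∑ i ∈ Finset.range n, f (ξ i ω, W i ω)) ∂P
      = ∫⁻ ω, expNeg (∑ i ∈ Finset.range n, φ (ξ i ω)) ∂P := by
    intro n
    have hG : Measurable fun p : (ℕ → E) × (ℕ → F) =>
        ∏ i ∈ Finset.range n, expNeg (f (p.1 i, p.2 i)) :=
      Finset.measurable_prod _ fun i _ => hef.comp
        (((measurable_pi_apply i).comp measurable_fst).prodMk
          ((measurable_pi_apply i).comp measurable_snd))
    have hmap := (indepFun_iff_map_prod_eq_prod_map_map hξm.aemeasurable hWm.aemeasurable).1 hξW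
    simp only [expNeg_sum, hφg]
    calc ∫⁻ ω, ∏ i ∈ Finset.range n, expNeg (f (ξ i ω, W i ω)) ∂P
        = ∫⁻ p, ∏ i ∈ Finset.range n, expNeg (f (p.1 i, p.2 i))
            ∂(P.map fun ω => ((fun i => ξ i ω), (fun i => W i ω))) := by
          rw [lintegral_map hG (hξm.prodMk hWm)]
      _ = ∫⁻ z, ∫⁻ w, ∏ i ∈ Finset.range n, expNeg (f (z i, w i))
            ∂(P.map fun ω i => W i ω) ∂(P.map fun ω i => ξ i ω) := by
          have := Measure.isProbabilityMeasure_map (μ := P) hWm.aemeasurable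
          rw [hmap, lintegral_prod _ hG.aemeasurable]
      _ = ∫⁻ z, ∏ i ∈ Finset.range n, g (z i) ∂(P.map fun ω i => ξ i ω) := by
          refine lintegral_congr fun z => ?_
          have hi : ∀ i, Measurable fun w => expNeg (f (z i, w)) :=
            fun i => hef.comp measurable_prodMk_left
          have hGz : Measurable fun w : ℕ → F =>
              ∏ i ∈ Finset.range n, expNeg (f (z i, w i)) :=
            hG.comp measurable_prodMk_left
          rw [lintegral_map hGz hWm]
          have := lintegral_prod_eq_prod_lintegral_of_indepFun (Finset.range n) _
            (hWi.comp _ hi) (fun i => (hi i).comp (hW i))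
          simp only [Function.comp_def] at this
          rw [this]
          refine Finset.prod_congr rfl fun i _ => ?_
          rw [← lintegral_map (hi i) (hW i), hν]
      _ = _ := by
          have hgp : Measurable fun z : ℕ → E => ∏ i ∈ Finset.range n, g (z i) :=
            Finset.measurable_prod _ fun i _ => hgm.comp (measurable_pi_apply i)
          rw [lintegral_map hgp hξm]
  have h1 := tendsto_lintegral_expNeg_sum (P := P)
    (fun i => hf.comp ((h.measurable i).prodMk (hW i)))
  have h2 := tendsto_lintegral_expNeg_sum (P := P) (fun i => hφm.comp (h.measurable i))
  simp only [Function.comp_def, key] at h1 h2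
  rw [tendsto_nhds_unique h1 h2, h.lintegral_expNeg hφm]
  simp only [hφg, hg]

/-- A sequence of points whose Laplace functional is that of a Poisson process with intensity
`μ`. -/
structure HasPoissonLaplace (ξ : ℕ → Ω → E) (μ : Measure E) (P : Measure Ω) : Prop where
  measurable : ∀ i, Measurable (ξ i)
  lintegral_expNeg : ∀ {f : E → ℝ≥0∞}, Measurable f →
    ∫⁻ ω, expNeg (∑' i, f (ξ i ω)) ∂P = expNeg (∫⁻ x, (1 - expNeg (f x)) ∂μ)

lemma IsPoissonProcess.hasPoissonLaplace_marked {ξ : ℕ → Ω → E} {Λ : Measure E}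
    (h : IsPoissonProcess ξ Λ P) {W : ℕ → Ω → F} {ν : Measure F} [IsProbabilityMeasure ν]
    (hW : ∀ i, Measurable (W i)) (hν : ∀ i, P.map (W i) = ν) (hWi : iIndepFun W P)
    (hξW : IndepFun (fun ω i => ξ i ω) (fun ω i => W i ω) P) :
    HasPoissonLaplace (fun i ω => (ξ i ω, W i ω)) (Λ.prod ν) P where
  measurable i := (h.measurable i).prodMk (hW i)
  lintegral_expNeg {f} hf := by
    have hef : Measurable fun p : E × F => expNeg (f p) := measurable_expNeg.comp hf
    have hef' : Measurable fun p : E × F => 1 - expNeg (f p) := measurable_const.sub hef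
    rw [h.lintegral_expNeg_marked hW hν hWi hξW hf, lintegral_prod _ hef'.aemeasurable]
    congr 1
    refine lintegral_congr fun x => ?_
    have hefx : Measurable fun w => expNeg (f (x, w)) := hef.comp measurable_prodMk_left
    rw [lintegral_sub hefx
      (((lintegral_mono fun w => expNeg_le_one _).trans_lt (by simp : ∫⁻ _, 1 ∂ν < ∞)).ne)
      (ae_of_all _ fun w => expNeg_le_one _)]
    simp

end

/-! ### Void probabilities and point counts from the Laplace functional -/

namespace HasPoissonLaplace
variable {Ω E : Type*} [MeasurableSpace Ω] [MeasurableSpace E] {ξ : ℕ → Ω → E} {μ : Measure E}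
  {P : Measure Ω}

/-- Void probabilities. -/
lemma measure_void (h : HasPoissonLaplace ξ μ P) {A : Set E} (hA : MeasurableSet A) :
    P {ω | ∀ i, ξ i ω ∉ A} = expNeg (μ A) := by
  -- With the value ∞ on `A`, the exponential of minus the sum is the indicator of the void event.
  have h1 := h.lintegral_expNeg (f := A.indicator fun _ => ∞) (measurable_const.indicator hA)
  have h2 : ∀ ω, expNeg (∑' i, A.indicator (fun _ => ∞) (ξ i ω))
      = {ω | ∀ i, ξ i ω ∉ A}.indicator 1 ω := by
    intro ω
    by_cases hω : ∀ i, ξ i ω ∉ A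
    · simp [hω]
    · have h3 := hω
      push Not at h3
      obtain ⟨i, hi⟩ := h3
      rw [indicator_of_notMem (by exact hω), expNeg_eq_zero]
      exact ENNReal.tsum_eq_top_of_eq_top ⟨i, by simp [hi]⟩
  have h4 : (fun x => 1 - expNeg (A.indicator (fun _ => ∞) x)) = A.indicator 1 := by
    ext x
    by_cases hx : x ∈ A <;> simp [hx]
  have hm : MeasurableSet {ω | ∀ i, ξ i ω ∉ A} := by
    rw [ofPred_forall]
    exact MeasurableSet.iInter fun i => h.measurable i hA.compl
  simp only [h2] at h1
  rwa [lintegral_indicator_one hm, h4, lintegral_indicator_one hA] at h1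

lemma ae_exists_mem (h : HasPoissonLaplace ξ μ P) {A : Set E}
    (hA : MeasurableSet A) (h0 : μ A = ∞) : ∀ᵐ ω ∂P, ∃ i, ξ i ω ∈ A := by
  have h1 := h.measure_void hA
  rw [h0, expNeg_top] at h1
  rw [ae_iff]
  simpa using h1

/-- For the number N of points in `A` and c > 0, e^{-cN} vanishes where N = ∞, so exp(-c μ(A)) ≤ E
e^{-cN} ≤ P(N < ∞), using 1 - e^{-c} ≤ c. Then c → 0. -/
lemma ae_finite [IsProbabilityMeasure P] (h : HasPoissonLaplace ξ μ P) {A : Set E}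
    (hA : MeasurableSet A) (hfin : μ A ≠ ∞) : ∀ᵐ ω ∂P, {i | ξ i ω ∈ A}.Finite := by
  set N : Ω → ℝ≥0∞ := fun ω => ∑' i, A.indicator 1 (ξ i ω) with hN
  have hNm : Measurable N := Measurable.tsum fun i =>
    (measurable_one.indicator hA).comp (h.measurable i)
  have hm : MeasurableSet {ω | N ω ≠ ∞} := (hNm (measurableSet_singleton ∞)).compl
  have hle : ∀ c : ℝ≥0∞, c ≠ 0 → expNeg (c * μ A) ≤ P {ω | N ω ≠ ∞} := by
    intro c hc
    have h1 := h.lintegral_expNeg (f := fun x => c * A.indicator 1 x)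
      ((measurable_one.indicator hA).const_mul c)
    have h4 : (fun x => 1 - expNeg (c * A.indicator 1 x))
        = fun x => A.indicator (fun _ => 1 - expNeg c) x := by
      ext x
      by_cases hx : x ∈ A <;> simp [hx]
    simp only [ENNReal.tsum_mul_left] at h1
    rw [h4, lintegral_indicator_const hA] at h1
    calc expNeg (c * μ A) ≤ expNeg ((1 - expNeg c) * μ A) := by
          refine expNeg_antitone (mul_le_mul_left ?_ _)
          rw [tsub_le_iff_right]
          rcases eq_or_ne c ∞ with rfl | hct
          · simp
          lift c to ℝ≥0 using hct
          rw [← ENNReal.ofReal_coe_nnreal, expNeg_ofReal (by positivity),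
            ← ENNReal.ofReal_add (by positivity) (by positivity), ← ENNReal.ofReal_one]
          refine ENNReal.ofReal_le_ofReal ?_
          linarith [Real.add_one_le_exp (-(c : ℝ))]
      _ = ∫⁻ ω, expNeg (c * N ω) ∂P := h1.symm
      _ ≤ ∫⁻ ω, {ω | N ω ≠ ∞}.indicator 1 ω ∂P := by
          refine lintegral_mono fun ω => ?_
          by_cases hω : N ω = ∞
          · simp [hω, ENNReal.mul_top hc]
          · rw [indicator_of_mem (by exact hω)]
            exact expNeg_le_one _
      _ = _ := lintegral_indicator_one hm
  have hlim : Tendsto (fun c : ℝ≥0∞ => expNeg (c * μ A)) (𝓝[≠] 0) (𝓝 1) := by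
    have h5 : Tendsto (fun c : ℝ≥0∞ => c * μ A) (𝓝 0) (𝓝 (0 * μ A)) :=
      ENNReal.Tendsto.mul_const tendsto_id (Or.inr hfin)
    have h6 := (continuous_expNeg.tendsto _).comp h5
    rw [zero_mul, expNeg_zero] at h6
    exact h6.mono_left nhdsWithin_le_nhds
  have h7 : 1 ≤ P {ω | N ω ≠ ∞} :=
    le_of_tendsto hlim (eventually_nhdsWithin_of_forall fun c hc => hle c hc)
  have h8 := (mem_ae_iff_prob_eq_one (μ := P) hm).2 (le_antisymm prob_le_one h7)
  filter_upwards [h8] with ω hω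
  have h9 : N ω ≠ ∞ := hω
  rw [hN] at h9
  simp only [tsum_indicator_one_eq_pointCount] at h9
  simpa [pointCount] using h9

/-- If `A` has positive finite measure and `D` has finite measure, then with positive probability
there is exactly one point in `A` and none in `D`. -/
lemma measure_eq_zero_of_measure_existsUnique [IsProbabilityMeasure P]
    (h : HasPoissonLaplace ξ μ P) {A D : Set E}
    (hA : MeasurableSet A) (hD : MeasurableSet D) (hAD : Disjoint A D) (hAf : μ A ≠ ∞)
    (hDf : μ D ≠ ∞) (hP : P {ω | (∃! i, ξ i ω ∈ A) ∧ ∀ i, ξ i ω ∉ D} = 0) : μ A = 0 := by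
  have hvoid := h.measure_void (hA.union hD)
  rw [measure_union hAD hD] at hvoid
  -- Test function: c on `A` and ∞ on `D`. With no point in `D` and the single-point event excluded,
  -- `A` has no point or at least two, and two points contribute at most e^{-2c}.
  have hle : ∀ c : ℝ≥0∞, expNeg ((1 - expNeg c) * μ A + μ D)
      ≤ expNeg (μ A + μ D) + expNeg c ^ 2 := by
    intro c
    have hind : Measurable fun x => c * A.indicator 1 x + D.indicator (fun _ => ∞) x :=
      ((measurable_one.indicator hA).const_mul c).add (measurable_const.indicator hD)
    have h1 := h.lintegral_expNeg hind
    have h4 : ∀ x, 1 - expNeg (c * A.indicator 1 x + D.indicator (fun _ => ∞) x)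
        = A.indicator (fun _ => 1 - expNeg c) x + D.indicator (fun _ => 1) x := by
      intro x
      by_cases hx : x ∈ A
      · simp [hx, disjoint_left.1 hAD hx]
      · by_cases hxD : x ∈ D <;> simp [hx, hxD]
    simp only [h4] at h1
    rw [lintegral_add_right _ (measurable_const.indicator hD), lintegral_indicator_const hA,
      lintegral_indicator_const hD, one_mul] at h1
    rw [← h1, ← hvoid]
    have hm : MeasurableSet {ω | ∀ i, ξ i ω ∉ A ∪ D} := by
      rw [ofPred_forall]
      exact MeasurableSet.iInter fun i => h.measurable i (hA.union hD).compl
    calc _ ≤ ∫⁻ ω, ({ω | ∀ i, ξ i ω ∉ A ∪ D}.indicator 1 ω + expNeg c ^ 2) ∂P := by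
          refine lintegral_mono_ae ?_
          have hP' : ∀ᵐ ω ∂P, ¬ ((∃! i, ξ i ω ∈ A) ∧ ∀ i, ξ i ω ∉ D) := by
            rw [ae_iff]; simpa using hP
          filter_upwards [hP'] with ω hω
          by_cases hωD : ∃ i, ξ i ω ∈ D
          · obtain ⟨i, hi⟩ := hωD
            rw [ENNReal.tsum_eq_top_of_eq_top ⟨i, by simp [hi]⟩]
            simp
          by_cases hωA : ∃ i, ξ i ω ∈ A
          · obtain ⟨i, hi⟩ := hωA
            have : ∃ j, j ≠ i ∧ ξ j ω ∈ A := by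
              by_contra hcon
              push Not at hcon hωD
              exact hω ⟨⟨i, hi, fun j hj => by_contra fun hji => hcon j hji hj⟩, hωD⟩
            obtain ⟨j, hji, hj⟩ := this
            refine le_add_left ?_
            rw [← expNeg_mul_natCast]
            refine expNeg_antitone ?_
            refine le_trans ?_ (ENNReal.sum_le_tsum {i, j})
            rw [Finset.sum_pair hji.symm]
            simp only [indicator_of_mem hi, indicator_of_mem hj, Pi.one_apply, mul_one]
            push_cast
            rw [mul_two]
            exact add_le_add le_self_add le_self_add
          · push Not at hωA hωD
            refine le_add_right ?_
            rw [indicator_of_mem (by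
              intro i hi
              exact hi.elim (hωA i) (hωD i))]
            exact expNeg_le_one _
      _ = _ := by
          rw [lintegral_add_right _ measurable_const, lintegral_indicator_one hm]
          simp
  lift μ A to ℝ≥0 using hAf with m
  lift μ D to ℝ≥0 using hDf with b
  by_contra hm0
  have hm0' : 0 < (m : ℝ) := by
    have : m ≠ 0 := by exact_mod_cast hm0
    positivity
  set K : ℝ := Real.exp (-(m + b)) with hK
  have hKpos : 0 < K := Real.exp_pos _
  -- For t = e^{-c} the bound reads K e^{tm} ≤ K + t². The left side grows linearly in t and the
  -- error only quadratically, so small t forces m = 0.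
  have hreal : ∀ t : ℝ, 0 < t → t ≤ 1 → K * m ≤ t := by
    intro t ht ht1
    have h1 := hle (ENNReal.ofReal (-Real.log t))
    have h2 : 0 ≤ -Real.log t := by
      have := Real.log_nonpos ht.le ht1
      linarith
    rw [expNeg_ofReal h2, neg_neg, Real.exp_log ht, ← ENNReal.ofReal_coe_nnreal (p := m),
      ← ENNReal.ofReal_coe_nnreal (p := b), ← ENNReal.ofReal_one,
      ← ENNReal.ofReal_sub _ ht.le, ← ENNReal.ofReal_mul (by linarith),
      ← ENNReal.ofReal_add (mul_nonneg (by linarith) (by positivity)) (by positivity),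
      ← ENNReal.ofReal_add (by positivity) (by positivity),
      expNeg_ofReal (add_nonneg (mul_nonneg (by linarith) (by positivity)) (by positivity)),
      expNeg_ofReal (by positivity), ← ENNReal.ofReal_pow ht.le,
      ← ENNReal.ofReal_add (by positivity) (by positivity),
      ENNReal.ofReal_le_ofReal_iff (by positivity)] at h1
    have h3 : Real.exp (-((1 - t) * m + b)) = K * Real.exp (t * m) := by
      rw [hK, ← Real.exp_add]
      congr 1
      ring
    rw [h3, ← hK] at h1
    have h4 := mul_le_mul_of_nonneg_left (Real.add_one_le_exp (t * m)) hKpos.le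
    have h5 : t * (K * m) ≤ t * t := by nlinarith
    exact le_of_mul_le_mul_left h5 ht
  have hKm : 0 < K * m := by positivity
  have := hreal (min 1 (K * m / 2)) (by positivity) (min_le_left _ _)
  have := min_le_right 1 (K * m / 2)
  linarith

end HasPoissonLaplace

/-! ### The Fréchet intensity and exceedance sets -/

lemma frechetIntensity_Ioi {a : ℝ} (ha : 0 < a) :
    frechetIntensity (Ioi a) = ENNReal.ofReal a⁻¹ := by
  have h2 : (-2 : ℝ) < -1 := by norm_num
  have hcongr : ∀ z ∈ Ioi a, z ^ (-2 : ℝ) = (z ^ 2)⁻¹ := fun z hz => by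
    rw [Real.rpow_neg (ha.trans hz).le, Real.rpow_ofNat]
  have hint : IntegrableOn (fun z : ℝ => (z ^ 2)⁻¹) (Ioi a) :=
    (integrableOn_Ioi_rpow_of_lt h2 ha).congr_fun hcongr measurableSet_Ioi
  rw [frechetIntensity, withDensity_apply _ measurableSet_Ioi,
    Measure.restrict_restrict measurableSet_Ioi,
    inter_eq_left.2 (Ioi_subset_Ioi ha.le),
    ← ofReal_integral_eq_lintegral_ofReal hint (ae_of_all _ fun z => by positivity),
    ← setIntegral_congr_fun measurableSet_Ioi hcongr, integral_Ioi_rpow_of_lt h2 ha]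
  congr 1
  norm_num
  rw [Real.rpow_neg_one]

lemma frechetIntensity_setOf_lt_mul {x u : ℝ} (hx : 0 < x) (hu : 0 ≤ u) :
    frechetIntensity {z | x < z * u} = ENNReal.ofReal (u / x) := by
  rcases hu.eq_or_lt with rfl | hu
  · simp [hx.not_gt]
  · have : {z | x < z * u} = Ioi (x / u) := by
      ext z
      exact (div_lt_iff₀ hu).symm
    rw [this, frechetIntensity_Ioi (by positivity), inv_div]

instance : SigmaFinite frechetIntensity := SigmaFinite.withDensity_ofReal _

section
variable {F : Type*} [MeasurableSpace F]

/-- The set of marked points `(z, w)` with `z g(w) > x`. -/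
def exceed (g : F → ℝ) (x : ℝ) : Set (ℝ × F) := {p | x < p.1 * g p.2}

lemma measurableSet_exceed {g : F → ℝ} (hg : Measurable g) (x : ℝ) :
    MeasurableSet (exceed g x) :=
  measurableSet_lt measurable_const (measurable_fst.mul (hg.comp measurable_snd))

variable {ν : Measure F} [IsProbabilityMeasure ν]

lemma measure_exceed {g : F → ℝ} (hg : Measurable g) (hg0 : ∀ᵐ w ∂ν, 0 ≤ g w)
    {x : ℝ} (hx : 0 < x) :
    (frechetIntensity.prod ν) (exceed g x)
      = (∫⁻ w, ENNReal.ofReal (g w) ∂ν) * ENNReal.ofReal x⁻¹ := by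
  rw [Measure.prod_apply_symm (measurableSet_exceed hg x),
    ← lintegral_mul_const _ hg.ennreal_ofReal]
  refine lintegral_congr_ae ?_
  filter_upwards [hg0] with w hw
  rw [← ENNReal.ofReal_mul hw, ← div_eq_mul_inv]
  exact frechetIntensity_setOf_lt_mul hx hw

lemma ae_section_eq_zero {S : Set (ℝ × F)} (hS : MeasurableSet S)
    (h0 : (frechetIntensity.prod ν) S = 0) :
    ∀ᵐ w ∂ν, frechetIntensity {z | (z, w) ∈ S} = 0 := by
  rw [Measure.prod_apply_symm hS, lintegral_eq_zero_iff (measurable_measure_prodMk_right hS)] at h0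
  exact h0

/-- For almost every fixed mark `w` with `g w ≥ 0`, the section {z : z g(w) > 1} has mass exactly
g(w), so inclusion of sections up to a null set compares the values. -/
lemma ae_le_of_measure_exceed_diff {g g' : F → ℝ} (hg : Measurable g) (hg' : Measurable g')
    (hg0 : ∀ᵐ w ∂ν, 0 ≤ g w) (hg0' : ∀ᵐ w ∂ν, 0 ≤ g' w)
    (h0 : (frechetIntensity.prod ν) (exceed g 1 \ exceed g' 1) = 0) :
    ∀ᵐ w ∂ν, g w ≤ g' w := by
  filter_upwards [hg0, hg0',
    ae_section_eq_zero ((measurableSet_exceed hg 1).diff (measurableSet_exceed hg' 1)) h0]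
    with w h1 h2 h3
  have h4 : frechetIntensity {z | 1 < z * g w} ≤ frechetIntensity {z | 1 < z * g' w} := by
    calc _ ≤ frechetIntensity ({z | (z, w) ∈ exceed g 1 \ exceed g' 1} ∪ {z | 1 < z * g' w}) := by
          refine measure_mono fun z hz => ?_
          by_cases hz' : 1 < z * g' w
          · exact Or.inr hz'
          · exact Or.inl ⟨hz, hz'⟩
      _ ≤ _ := (measure_union_le _ _).trans (by rw [h3, zero_add])
  rwa [frechetIntensity_setOf_lt_mul one_pos h1, frechetIntensity_setOf_lt_mul one_pos h2, div_one,
    div_one, ENNReal.ofReal_le_ofReal_iff h2] at h4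

/-- On positive z, the section of the intersection at `w` is {z : z min(g(w), g'(w)) > 1}, whose
mass is that minimum. -/
lemma ae_eq_zero_or_of_measure_exceed_inter {g g' : F → ℝ} (hg : Measurable g)
    (hg' : Measurable g') (hg0 : ∀ᵐ w ∂ν, 0 ≤ g w) (hg0' : ∀ᵐ w ∂ν, 0 ≤ g' w)
    (h0 : (frechetIntensity.prod ν) (exceed g 1 ∩ exceed g' 1) = 0) :
    ∀ᵐ w ∂ν, g w = 0 ∨ g' w = 0 := by
  filter_upwards [hg0, hg0',
    ae_section_eq_zero ((measurableSet_exceed hg 1).inter (measurableSet_exceed hg' 1)) h0]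
    with w h1 h2 h3
  have h4 : {z | (z, w) ∈ exceed g 1 ∩ exceed g' 1} ⊇ Ioi 0 ∩ {z | 1 < z * min (g w) (g' w)} := by
    rintro z ⟨hz, hz'⟩
    have hz0 : 0 ≤ z := le_of_lt hz
    exact ⟨lt_of_lt_of_le hz' (mul_le_mul_of_nonneg_left (min_le_left _ _) hz0),
      lt_of_lt_of_le hz' (mul_le_mul_of_nonneg_left (min_le_right _ _) hz0)⟩
  have hmin : 0 ≤ min (g w) (g' w) := le_min h1 h2
  have h5 : Ioi 0 ∩ {z | 1 < z * min (g w) (g' w)} = {z | 1 < z * min (g w) (g' w)} := by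
    refine inter_eq_right.2 fun z hz => ?_
    have hz' : 0 < z * min (g w) (g' w) := one_pos.trans hz
    exact pos_of_mul_pos_left hz' hmin
  rw [h5] at h4
  have h6 := measure_mono_null h4 h3
  rw [frechetIntensity_setOf_lt_mul one_pos hmin, div_one, ENNReal.ofReal_eq_zero] at h6
  rcases min_le_iff.1 h6 with h | h
  · exact Or.inl (le_antisymm h h1)
  · exact Or.inr (le_antisymm h h2)

lemma measure_exceed_inter_eq_zero {g g' : F → ℝ} (hg : Measurable g)
    (hg' : Measurable g') (h0 : ∀ᵐ w ∂ν, g w = 0 ∨ g' w = 0) {x y : ℝ} (hx : 0 < x) (hy : 0 < y) :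
    (frechetIntensity.prod ν) (exceed g x ∩ exceed g' y) = 0 := by
  rw [Measure.prod_apply_symm ((measurableSet_exceed hg x).inter (measurableSet_exceed hg' y)),
    lintegral_eq_zero_iff (measurable_measure_prodMk_right
      ((measurableSet_exceed hg x).inter (measurableSet_exceed hg' y)))]
  filter_upwards [h0] with w hw
  have : (fun z => (z, w)) ⁻¹' (exceed g x ∩ exceed g' y) = ∅ := by
    ext z
    rcases hw with hw | hw
    · simp [exceed, hw, hx.le]
    · simp [exceed, hw, hy.le]
  rw [this]
  simp

end

/-! ### Suprema that are positive, finite and attained -/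

lemma exists_iSup_eq_of_finite {a : ℕ → ℝ} (hfin : ∀ n : ℕ, {i | 1 / ((n : ℝ) + 1) < a i}.Finite)
    (hpos : ∃ i, 0 < a i) : BddAbove (range a) ∧ 0 < ⨆ i, a i ∧ ∃ l, ⨆ i, a i = a l := by
  obtain ⟨i, hi⟩ := hpos
  obtain ⟨n, hn⟩ := exists_nat_one_div_lt hi
  obtain ⟨l, hl, hmax⟩ := (hfin n).exists_maximalFor a _ ⟨i, hn⟩
  have hle : ∀ j, a j ≤ a l := by
    intro j
    by_cases hj : 1 / ((n : ℝ) + 1) < a j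
    · exact (le_total (a j) (a l)).elim id fun h => hmax hj h
    · exact (not_lt.1 hj).trans (le_of_lt hl)
  have hbdd : BddAbove (range a) := ⟨a l, by rintro _ ⟨j, rfl⟩; exact hle j⟩
  have heq : ⨆ i, a i = a l := le_antisymm (ciSup_le hle) (le_ciSup hbdd l)
  exact ⟨hbdd, heq ▸ hi.trans_le (hle i), l, heq⟩

section
variable {Ω F : Type*} [MeasurableSpace Ω] [MeasurableSpace F] {P : Measure Ω}
  [IsProbabilityMeasure P] {ν : Measure F} [IsProbabilityMeasure ν]
  {ζ : ℕ → Ω → ℝ} {W : ℕ → Ω → F}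

lemma HasPoissonLaplace.ae_iSup
    (h : HasPoissonLaplace (fun i ω => (ζ i ω, W i ω)) (frechetIntensity.prod ν) P)
    {g : F → ℝ} (hg : Measurable g) (hg0 : ∀ᵐ w ∂ν, 0 ≤ g w)
    (hg1 : ∫⁻ w, ENNReal.ofReal (g w) ∂ν = 1) :
    ∀ᵐ ω ∂P, BddAbove (range fun i => ζ i ω * g (W i ω)) ∧ 0 < ⨆ i, ζ i ω * g (W i ω) ∧
      ∃ l, ⨆ i, ζ i ω * g (W i ω) = ζ l ω * g (W l ω) := by
  -- Exceedance sets have finite mass 1/x at each level x > 0, but infinite mass at level 0; hence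
  -- finitely many points above each positive level and at least one above 0.
  have h1 : ∀ n : ℕ, ∀ᵐ ω ∂P, {i | 1 / ((n : ℝ) + 1) < ζ i ω * g (W i ω)}.Finite := by
    intro n
    have hn : 0 < 1 / ((n : ℝ) + 1) := by positivity
    refine h.ae_finite (measurableSet_exceed hg _) ?_
    rw [measure_exceed hg hg0 hn, hg1, one_mul]
    exact ENNReal.ofReal_ne_top
  have h2 : ∀ᵐ ω ∂P, ∃ i, 0 < ζ i ω * g (W i ω) := by
    refine h.ae_exists_mem (measurableSet_exceed hg 0) (ENNReal.eq_top_of_forall_nnreal_le ?_)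
    intro r
    have hr : 0 < ((r : ℝ) + 1)⁻¹ := by positivity
    calc (r : ℝ≥0∞) ≤ ENNReal.ofReal (r + 1) := by
          rw [← ENNReal.ofReal_coe_nnreal]
          exact ENNReal.ofReal_le_ofReal (by linarith)
      _ = (frechetIntensity.prod ν) (exceed g ((r : ℝ) + 1)⁻¹) := by
          rw [measure_exceed hg hg0 hr, hg1, one_mul, inv_inv]
      _ ≤ _ := measure_mono fun p (hp : _ < _) => hr.trans hp
  filter_upwards [ae_all_iff.2 h1, h2] with ω hω hω'
  exact exists_iSup_eq_of_finite hω hω'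

end

/-! ### Concurrence for two functionals of the marks -/

/-- A non-negative measurable functional of the marks, with mean one. -/
structure IsUnitMeanFunctional {F : Type*} [MeasurableSpace F] (g : F → ℝ) (ν : Measure F) :
    Prop where
  measurable : Measurable g
  nonneg : ∀ᵐ w ∂ν, 0 ≤ g w
  lintegral_eq_one : ∫⁻ w, ENNReal.ofReal (g w) ∂ν = 1

/-- The supremum `max_i ζ_i g(W_i)`. -/
def markedSup {Ω F : Type*} (ζ : ℕ → Ω → ℝ) (W : ℕ → Ω → F) (g : F → ℝ) (ω : Ω) : ℝ :=
  ⨆ i, ζ i ω * g (W i ω)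

/-- The event that one and the same marked point attains the suprema of `g` and of `g'`. -/
def concurrenceSet {Ω F : Type*} (ζ : ℕ → Ω → ℝ) (W : ℕ → Ω → F) (g g' : F → ℝ) : Set Ω :=
  {ω | ∃ l, markedSup ζ W g ω = ζ l ω * g (W l ω) ∧ markedSup ζ W g' ω = ζ l ω * g' (W l ω)}

lemma concurrenceSet_comm {Ω F : Type*} (ζ : ℕ → Ω → ℝ) (W : ℕ → Ω → F) (g g' : F → ℝ) :
    concurrenceSet ζ W g g' = concurrenceSet ζ W g' g := by
  simp only [concurrenceSet, and_comm]

namespace HasPoissonLaplace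

variable {Ω F : Type*} [MeasurableSpace Ω] [MeasurableSpace F] {P : Measure Ω}
  {ν : Measure F} {ζ : ℕ → Ω → ℝ} {W : ℕ → Ω → F} {g g' : F → ℝ}
  (h : HasPoissonLaplace (fun i ω => (ζ i ω, W i ω)) (frechetIntensity.prod ν) P)
  (hg : IsUnitMeanFunctional g ν) (hg' : IsUnitMeanFunctional g' ν)

lemma _root_.MaxStable.IsUnitMeanFunctional.measure_exceed_one [IsProbabilityMeasure ν]
    (hg : IsUnitMeanFunctional g ν) :
    (frechetIntensity.prod ν) (exceed g 1) = 1 := by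
  rw [measure_exceed hg.measurable hg.nonneg one_pos, hg.lintegral_eq_one]
  simp

include h in
lemma measurable_mul (hg : Measurable g) (i : ℕ) : Measurable fun ω => ζ i ω * g (W i ω) :=
  (measurable_fst.mul (hg.comp measurable_snd)).comp (h.measurable i)

include h in
lemma measurable_markedSup (hg : Measurable g) : Measurable (markedSup ζ W g) :=
  Measurable.iSup fun i => h.measurable_mul hg i

include h in
lemma measurableSet_concurrenceSet (hg : Measurable g) (hg' : Measurable g') :
    MeasurableSet (concurrenceSet ζ W g g') := by
  rw [concurrenceSet, ofPred_exists]
  exact MeasurableSet.iUnion fun l =>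
    (measurableSet_eq_fun (h.measurable_markedSup hg) (h.measurable_mul hg l)).inter
      (measurableSet_eq_fun (h.measurable_markedSup hg') (h.measurable_mul hg' l))

variable [IsProbabilityMeasure P] [IsProbabilityMeasure ν]

include h hg in
lemma ae_markedSup : ∀ᵐ ω ∂P, BddAbove (range fun i => ζ i ω * g (W i ω)) ∧
    0 < markedSup ζ W g ω ∧ ∃ l, markedSup ζ W g ω = ζ l ω * g (W l ω) :=
  h.ae_iSup hg.measurable hg.nonneg hg.lintegral_eq_one

include h hg in
-- Almost sure boundedness rules out the default value of a real supremum, with one exceptional null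
-- set for all levels.
lemma ae_markedSup_le_iff :
    ∀ᵐ ω ∂P, ∀ x, markedSup ζ W g ω ≤ x ↔ ∀ i, (ζ i ω, W i ω) ∉ exceed g x := by
  filter_upwards [h.ae_markedSup hg] with ω hω x
  simp only [exceed, mem_ofPred_eq, not_lt]
  exact ciSup_le_iff hω.1

include h hg in
lemma measure_markedSup_le (x : ℝ) :
    P (markedSup ζ W g ⁻¹' Iic x) = expNeg ((frechetIntensity.prod ν) (exceed g x)) := by
  rw [← h.measure_void (measurableSet_exceed hg.measurable x)]
  refine measure_congr ?_
  filter_upwards [h.ae_markedSup_le_iff hg] with ω hω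
  exact propext (hω x)

include h hg hg' in
lemma measure_markedSup_le_inter (x y : ℝ) :
    P (markedSup ζ W g ⁻¹' Iic x ∩ markedSup ζ W g' ⁻¹' Iic y)
      = expNeg ((frechetIntensity.prod ν) (exceed g x ∪ exceed g' y)) := by
  rw [← h.measure_void ((measurableSet_exceed hg.measurable x).union
    (measurableSet_exceed hg'.measurable y))]
  refine measure_congr ?_
  filter_upwards [h.ae_markedSup_le_iff hg, h.ae_markedSup_le_iff hg'] with ω hω hω'
  refine propext ((and_congr (hω x) (hω' y)).trans ?_)
  rw [← forall_and]
  exact forall_congr' fun i => not_or.symm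

include h hg hg' in
lemma indepFun_markedSup (h0 : ∀ᵐ w ∂ν, g w = 0 ∨ g' w = 0) :
    IndepFun (markedSup ζ W g) (markedSup ζ W g') P := by
  have hm := h.measurable_markedSup hg.measurable
  have hm' := h.measurable_markedSup hg'.measurable
  have hgen : ∀ f : Ω → ℝ, MeasurableSpace.comap f inferInstance
      = MeasurableSpace.generateFrom (preimage f '' range Iic) := fun f => by
    rw [← MeasurableSpace.comap_generateFrom, ← borel_eq_generateFrom_Iic,
      BorelSpace.measurable_eq (α := ℝ)]
  have hpi : ∀ f : Ω → ℝ, IsPiSystem (preimage f '' range Iic) := by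
    rintro f _ ⟨_, ⟨x, rfl⟩, rfl⟩ _ ⟨_, ⟨y, rfl⟩, rfl⟩ -
    exact ⟨Iic (min x y), ⟨_, rfl⟩, by rw [← preimage_inter, Iic_inter_Iic]⟩
  have hnull : ∀ f : F → ℝ, IsUnitMeanFunctional f ν → ∀ x ≤ 0,
      P (markedSup ζ W f ⁻¹' Iic x) = 0 := by
    intro f hf x hx
    refine measure_mono_null ?_ (ae_iff.1 ((h.ae_markedSup hf).mono fun ω hω => hω.2.1))
    intro ω hω
    exact not_lt.2 (le_trans hω hx)
  rw [IndepFun_iff_Indep]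
  refine IndepSets.indep hm.comap_le hm'.comap_le (hpi _) (hpi _) (hgen _) (hgen _) ?_
  rw [IndepSets_iff]
  rintro _ _ ⟨_, ⟨x, rfl⟩, rfl⟩ ⟨_, ⟨y, rfl⟩, rfl⟩
  -- Exceedance sets are only known to have null intersection at positive levels; at other levels
  -- both sides vanish because the suprema are a.s. positive.
  rcases le_or_gt x 0 with hx | hx
  · rw [hnull g hg x hx, zero_mul]
    exact measure_mono_null inter_subset_left (hnull g hg x hx)
  rcases le_or_gt y 0 with hy | hy
  · rw [hnull g' hg' y hy, mul_zero]
    exact measure_mono_null inter_subset_right (hnull g' hg' y hy)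
  rw [h.measure_markedSup_le_inter hg hg', h.measure_markedSup_le hg, h.measure_markedSup_le hg',
    ← expNeg_add, ← measure_union_add_inter _ (measurableSet_exceed hg'.measurable y),
    measure_exceed_inter_eq_zero hg.measurable hg'.measurable h0 hx hy, add_zero]

include h hg hg' in
lemma ae_eq_zero_or_of_indepFun (hind : IndepFun (markedSup ζ W g) (markedSup ζ W g') P) :
    ∀ᵐ w ∂ν, g w = 0 ∨ g' w = 0 := by
  refine ae_eq_zero_or_of_measure_exceed_inter hg.measurable hg'.measurable hg.nonneg hg'.nonneg ?_
  have h1 := hind.measure_inter_preimage_eq_mul (Iic 1) (Iic 1) measurableSet_Iic measurableSet_Iic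
  rw [h.measure_markedSup_le_inter hg hg', h.measure_markedSup_le hg, h.measure_markedSup_le hg',
    ← expNeg_add, expNeg_injective.eq_iff,
    ← measure_union_add_inter _ (measurableSet_exceed hg'.measurable 1)] at h1
  have hfin : (frechetIntensity.prod ν) (exceed g 1 ∪ exceed g' 1) ≠ ∞ := by
    refine ((measure_union_le _ _).trans_lt ?_).ne
    rw [hg.measure_exceed_one, hg'.measure_exceed_one]
    simp
  nth_rw 1 [← add_zero ((frechetIntensity.prod ν) (exceed g 1 ∪ exceed g' 1))] at h1
  exact ((ENNReal.add_right_inj hfin).1 h1).symm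

include h hg hg' in
lemma ae_eq_zero_or_of_measure_concurrenceSet (h0 : P (concurrenceSet ζ W g g') = 0) :
    ∀ᵐ w ∂ν, g w = 0 ∨ g' w = 0 := by
  refine ae_eq_zero_or_of_measure_exceed_inter hg.measurable hg'.measurable hg.nonneg hg'.nonneg ?_
  have hm := measurableSet_exceed hg.measurable 1
  have hm' := measurableSet_exceed hg'.measurable 1
  have hA : (frechetIntensity.prod ν) (exceed g 1) ≠ ∞ := by simp [hg.measure_exceed_one]
  have hA' : (frechetIntensity.prod ν) (exceed g' 1) ≠ ∞ := by simp [hg'.measure_exceed_one]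
  refine h.measure_eq_zero_of_measure_existsUnique
    (D := (exceed g 1 ∪ exceed g' 1) \ (exceed g 1 ∩ exceed g' 1))
    (hm.inter hm') ((hm.union hm').diff (hm.inter hm')) disjoint_sdiff_right
    (measure_ne_top_of_subset inter_subset_left hA)
    (measure_ne_top_of_subset sdiff_subset
      ((measure_union_le _ _).trans_lt (ENNReal.add_lt_top.2 ⟨hA.lt_top, hA'.lt_top⟩)).ne) ?_
  refine measure_mono_null ?_ h0
  rintro ω ⟨⟨l, ⟨hl, hl'⟩, huniq⟩, hD⟩
  -- Any other point exceeding 1 for either functional would lie in the symmetric difference, or be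
  -- a second point of the intersection.
  have hj : ∀ j, j ≠ l → ζ j ω * g (W j ω) ≤ 1 ∧ ζ j ω * g' (W j ω) ≤ 1 := by
    intro j hjl
    by_contra hcon
    rw [not_and_or, not_le, not_le] at hcon
    exact hD j ⟨hcon, fun hj => hjl (huniq j hj)⟩
  have hmax : ∀ f : F → ℝ, 1 < ζ l ω * f (W l ω) → (∀ j, j ≠ l → ζ j ω * f (W j ω) ≤ 1) →
      markedSup ζ W f ω = ζ l ω * f (W l ω) := by
    intro f hf hf'
    have hle : ∀ j, ζ j ω * f (W j ω) ≤ ζ l ω * f (W l ω) := by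
      intro j
      rcases eq_or_ne j l with rfl | hjl
      · exact le_rfl
      · exact (hf' j hjl).trans hf.le
    exact le_antisymm (ciSup_le hle)
      (le_ciSup (f := fun j => ζ j ω * f (W j ω)) ⟨_, by rintro _ ⟨j, rfl⟩; exact hle j⟩ l)
  exact ⟨l, hmax g hl fun j hjl => (hj j hjl).1, hmax g' hl' fun j hjl => (hj j hjl).2⟩

lemma measure_concurrenceSet_eq_zero_of_ae
    (h : HasPoissonLaplace (fun i ω => (ζ i ω, W i ω)) (frechetIntensity.prod ν) P)
    (hg : IsUnitMeanFunctional g ν) (hg' : IsUnitMeanFunctional g' ν)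
    (h0 : ∀ᵐ ω ∂P, ∀ i, g (W i ω) = 0 ∨ g' (W i ω) = 0) : P (concurrenceSet ζ W g g') = 0 := by
  have h1 : ∀ᵐ ω ∂P, ω ∉ concurrenceSet ζ W g g' := by
    filter_upwards [h0, h.ae_markedSup hg, h.ae_markedSup hg'] with ω hω hη hη'
    rintro ⟨l, hl, hl'⟩
    rcases hω l with h2 | h2
    · have := hη.2.1
      rw [hl, h2, mul_zero] at this
      exact lt_irrefl _ this
    · have := hη'.2.1
      rw [hl', h2, mul_zero] at this
      exact lt_irrefl _ this
  rw [ae_iff] at h1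
  simpa using h1

include h hg hg' in
/-- The concurrence probability vanishes if and only if the two suprema are independent. -/
theorem measure_concurrenceSet_eq_zero_iff (hW : ∀ i, Measurable (W i))
    (hν : ∀ i, P.map (W i) = ν) :
    P (concurrenceSet ζ W g g') = 0 ↔ IndepFun (markedSup ζ W g) (markedSup ζ W g') P := by
  refine ⟨fun h0 => h.indepFun_markedSup hg hg'
    (h.ae_eq_zero_or_of_measure_concurrenceSet hg hg' h0), fun hind => ?_⟩
  refine h.measure_concurrenceSet_eq_zero_of_ae hg hg' (ae_all_iff.2 fun i => ?_)
  have h1 := h.ae_eq_zero_or_of_indepFun hg hg' hind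
  rw [← hν i] at h1
  exact ae_of_ae_map (hW i).aemeasurable h1

include h hg hg' in
lemma measure_diff_eq_zero_of_ae_eq (heq : markedSup ζ W g =ᵐ[P] markedSup ζ W g') :
    (frechetIntensity.prod ν) (exceed g 1 \ exceed g' 1) = 0 := by
  have h1 : P (markedSup ζ W g ⁻¹' Iic 1 ∩ markedSup ζ W g' ⁻¹' Iic 1)
      = P (markedSup ζ W g' ⁻¹' Iic 1) := by
    refine measure_congr ?_
    filter_upwards [heq] with ω hω
    refine propext ⟨fun hh => hh.2, fun hh => ⟨?_, hh⟩⟩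
    exact hω.trans_le hh
  rw [h.measure_markedSup_le_inter hg hg', h.measure_markedSup_le hg', expNeg_injective.eq_iff,
    ← sdiff_union_self, measure_union disjoint_sdiff_left (measurableSet_exceed hg'.measurable 1),
    hg'.measure_exceed_one] at h1
  exact (ENNReal.add_left_inj ENNReal.one_ne_top).1 (h1.trans (zero_add 1).symm)

include h hg hg' in
lemma measure_diff_eq_zero_of_concurrence (h0 : P (concurrenceSet ζ W g g') = 1) :
    (frechetIntensity.prod ν) (exceed g 1 \ exceed g' 1) = 0 := by
  have hm := measurableSet_exceed hg.measurable 1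
  have hm' := measurableSet_exceed hg'.measurable 1
  set μ := frechetIntensity.prod ν with hμ
  set A := exceed g 1 with hA
  set B := exceed g' 1 with hB
  set V : Set (ℝ × F) → Set Ω := fun S => {ω | ∀ i, (ζ i ω, W i ω) ∉ S} with hV
  have hVm : ∀ S, MeasurableSet S → MeasurableSet (V S) := fun S hS => by
    simp only [hV, ofPred_forall]
    exact MeasurableSet.iInter fun i => h.measurable i hS.compl
  have hVP : ∀ S, MeasurableSet S → P (V S) = expNeg (μ S) := fun S hS => h.measure_void hS
  have hVunion : ∀ S T, V (S ∪ T) = V S ∩ V T := fun S T => by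
    ext ω
    simp only [hV, mem_union, not_or, mem_inter_iff, mem_ofPred_eq, forall_and]
  -- Points in both differences would push both suprema above 1, and the concurrent point would then
  -- lie in `A ∩ B`.
  have hsub : ∀ᵐ ω ∂P, ω ∈ V (A ∩ B) → ω ∈ V (A \ B) ∪ V (B \ A) := by
    have h0' := (mem_ae_iff_prob_eq_one
      (h.measurableSet_concurrenceSet hg.measurable hg'.measurable)).2 h0
    filter_upwards [h0', h.ae_markedSup hg, h.ae_markedSup hg'] with ω hω hη hη' hAB
    by_contra hcon
    simp only [hV, mem_union, not_or, mem_ofPred_eq, not_forall, not_not] at hcon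
    obtain ⟨⟨i, hi⟩, ⟨j, hj⟩⟩ := hcon
    obtain ⟨l, hl, hl'⟩ := hω
    refine hAB l ⟨?_, ?_⟩
    · have : 1 < ζ i ω * g (W i ω) := hi.1
      exact (this.trans_le (le_ciSup hη.1 i)).trans_eq hl
    · have : 1 < ζ j ω * g' (W j ω) := hj.1
      exact (this.trans_le (le_ciSup hη'.1 j)).trans_eq hl'
  have hfinA : μ A = 1 := hg.measure_exceed_one
  have hfinB : μ B = 1 := hg'.measure_exceed_one
  have hAd := measure_inter_add_sdiff (μ := μ) A hm'
  have hBd := measure_inter_add_sdiff (μ := μ) B hm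
  rw [inter_comm] at hBd
  have hcne : μ (A ∩ B) ≠ ∞ := measure_ne_top_of_subset inter_subset_left (by simp [hfinA])
  have hab : μ (A \ B) = μ (B \ A) := by
    rw [hfinA, ← hfinB, ← hBd] at hAd
    exact (ENNReal.add_right_inj hcne).1 hAd
  -- Inclusion–exclusion for the two void events inside `V (A ∩ B)`.
  have hle : P (V (A ∩ B)) + P (V (A ∩ B ∪ (A \ B ∪ B \ A)))
      ≤ P (V (A ∩ B ∪ A \ B)) + P (V (A ∩ B ∪ B \ A)) := by
    simp only [hVunion]
    have h2 : P (V (A ∩ B)) ≤ P (V (A ∩ B) ∩ V (A \ B) ∪ V (A ∩ B) ∩ V (B \ A)) := by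
      refine measure_mono_ae ?_
      filter_upwards [hsub] with ω hω hh
      exact (hω hh).imp (fun h3 => ⟨hh, h3⟩) (fun h3 => ⟨hh, h3⟩)
    rw [← measure_union_add_inter _
      ((hVm _ (hm.inter hm')).inter (hVm _ (hm'.diff hm))), ← inter_inter_distrib_left]
    exact add_le_add_left h2 _
  have hd1 : Disjoint (A ∩ B) (A \ B) := disjoint_sdiff_inter.symm
  have hd2 : Disjoint (A ∩ B) (B \ A) := by
    rw [inter_comm]; exact disjoint_sdiff_inter.symm
  have hd3 : Disjoint (A \ B) (B \ A) := disjoint_sdiff_sdiff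
  rw [hVP _ (hm.inter hm'), hVP _ ((hm.inter hm').union ((hm.diff hm').union (hm'.diff hm))),
    hVP _ ((hm.inter hm').union (hm.diff hm')), hVP _ ((hm.inter hm').union (hm'.diff hm)),
    measure_union (hd1.union_right hd2) ((hm.diff hm').union (hm'.diff hm)),
    measure_union hd1 (hm.diff hm'), measure_union hd2 (hm'.diff hm),
    measure_union hd3 (hm'.diff hm), ← hab] at hle
  simp only [expNeg_add] at hle
  have hc0 : expNeg (μ (A ∩ B)) ≠ 0 := fun hh => hcne (expNeg_eq_zero.1 hh)
  rw [← mul_add, ← mul_one_add,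
    ENNReal.mul_le_mul_iff_right hc0 (expNeg_ne_top _)] at hle
  -- After cancelling the common factor, `hle` says (1 - t)² ≤ 0.
  have ht : expNeg (μ (A \ B)) = 1 := by
    have ht1 := expNeg_le_one (μ (A \ B))
    generalize expNeg (μ (A \ B)) = t at *
    lift t to ℝ≥0 using (ht1.trans_lt ENNReal.one_lt_top).ne
    norm_cast at *
    have hle' : 1 + (t : ℝ) * t ≤ t + t := by exact_mod_cast hle
    have : (t : ℝ) = 1 := by nlinarith [sq_nonneg ((t : ℝ) - 1)]
    exact_mod_cast this
  exact expNeg_eq_one.1 ht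

include h hg hg' in
/-- The concurrence probability is one if and only if the two suprema agree almost surely. -/
theorem measure_concurrenceSet_eq_one_iff (hW : ∀ i, Measurable (W i))
    (hν : ∀ i, P.map (W i) = ν) :
    P (concurrenceSet ζ W g g') = 1 ↔ markedSup ζ W g =ᵐ[P] markedSup ζ W g' := by
  have hmarks : (frechetIntensity.prod ν) (exceed g 1 \ exceed g' 1) = 0 →
      (frechetIntensity.prod ν) (exceed g' 1 \ exceed g 1) = 0 →
      ∀ᵐ ω ∂P, ∀ i, g (W i ω) = g' (W i ω) := by
    intro h1 h2
    refine ae_all_iff.2 fun i => ?_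
    have h3 : ∀ᵐ w ∂ν, g w = g' w := by
      filter_upwards [
        ae_le_of_measure_exceed_diff hg.measurable hg'.measurable hg.nonneg hg'.nonneg h1,
        ae_le_of_measure_exceed_diff hg'.measurable hg.measurable hg'.nonneg hg.nonneg h2]
        with w h4 h5
      exact le_antisymm h4 h5
    rw [← hν i] at h3
    exact ae_of_ae_map (hW i).aemeasurable h3
  constructor
  · intro h0
    filter_upwards [hmarks (h.measure_diff_eq_zero_of_concurrence hg hg' h0)
      (h.measure_diff_eq_zero_of_concurrence hg' hg (concurrenceSet_comm ζ W g g' ▸ h0))] with ω hω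
    simp only [markedSup, hω]
  · intro heq
    refine (mem_ae_iff_prob_eq_one
      (h.measurableSet_concurrenceSet hg.measurable hg'.measurable)).1 ?_
    filter_upwards [hmarks (h.measure_diff_eq_zero_of_ae_eq hg hg' heq)
      (h.measure_diff_eq_zero_of_ae_eq hg' hg heq.symm), h.ae_markedSup hg] with ω hω hη
    obtain ⟨l, hl⟩ := hη.2.2
    refine ⟨l, hl, ?_⟩
    simpa only [markedSup, hω] using hl

end HasPoissonLaplace

/-! ### Application to the spectral representation -/

section
variable {Ω T : Type*} [MeasurableSpace Ω] {P : Measure Ω} {ζ : ℕ → Ω → ℝ} {Y : ℕ → T → Ω → ℝ}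

/-- The mark of a point is the whole path, and the two functionals are its evaluations at the two
sites. -/
lemma concurrenceProb_pair (s₁ s₂ : T) :
    concurrenceProb P ζ Y ![s₁, s₂] = P.real (concurrenceSet ζ (fun i ω s => Y i s ω)
      (fun y => y s₁) (fun y => y s₂)) := by
  simp only [concurrenceProb, Fin.forall_fin_two]
  rfl

variable [TopologicalSpace T]

lemma IsSpectralProcess.measurable_path {Y : T → Ω → ℝ} (h : IsSpectralProcess Y P) :
    Measurable fun ω s => Y s ω :=
  measurable_pi_lambda _ h.measurable

lemma IsSpectralProcess.isUnitMeanFunctional_eval {Y : T → Ω → ℝ} (h : IsSpectralProcess Y P)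
    (s : T) : IsUnitMeanFunctional (fun y : T → ℝ => y s) (P.map fun ω s => Y s ω) where
  measurable := measurable_pi_apply s
  nonneg := (ae_map_iff h.measurable_path.aemeasurable
    (measurableSet_le measurable_const (measurable_pi_apply s))).2 (ae_of_all _ (h.nonneg s))
  lintegral_eq_one := by
    have hint : Integrable (Y s) P := by
      by_contra hcon
      have := h.mean_one s
      rw [integral_undef hcon] at this
      exact zero_ne_one this
    rw [lintegral_map (measurable_pi_apply s).ennreal_ofReal h.measurable_path,
      ← ofReal_integral_eq_lintegral_ofReal hint (ae_of_all _ (h.nonneg s)), h.mean_one s,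
      ENNReal.ofReal_one]

variable [IsProbabilityMeasure P]

lemma IsSpectralData.hasPoissonLaplace (h : IsSpectralData ζ Y P) :
    HasPoissonLaplace (fun i ω => (ζ i ω, fun s => Y i s ω))
      (frechetIntensity.prod (P.map fun ω s => Y 0 s ω)) P := by
  have := Measure.isProbabilityMeasure_map (μ := P) (h.spectral 0).measurable_path.aemeasurable
  exact h.poisson.hasPoissonLaplace_marked (fun i => (h.spectral i).measurable_path)
    (fun i => (h.identDistrib i).map_eq) h.iIndep h.indep

end

end MaxStable

end

theorem mainTheorem8 {d : ℕ} (𝒳 : Set (EuclideanSpace ℝ (Fin d))) (h𝒳 : IsCompact 𝒳)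
    {Ω : Type*} [MeasurableSpace Ω] (P : Measure Ω) [IsProbabilityMeasure P]
    (ζ : ℕ → Ω → ℝ) (Y : ℕ → 𝒳 → Ω → ℝ) (h : MaxStable.IsSpectralData ζ Y P) (s₁ s₂ : 𝒳) :
    (MaxStable.concurrenceProb P ζ Y ![s₁, s₂] = 0 ↔
      IndepFun (MaxStable.eta ζ Y s₁) (MaxStable.eta ζ Y s₂) P) ∧
    (MaxStable.concurrenceProb P ζ Y ![s₁, s₂] = 1 ↔
      MaxStable.eta ζ Y s₁ =ᵐ[P] MaxStable.eta ζ Y s₂) := by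
  have hY : ∀ i, Measurable fun ω s => Y i s ω := fun i => (h.spectral i).measurable_path
  have := Measure.isProbabilityMeasure_map (μ := P) (hY 0).aemeasurable
  have hν : ∀ i, P.map (fun ω s => Y i s ω) = P.map fun ω s => Y 0 s ω :=
    fun i => (h.identDistrib i).map_eq
  have h₁ := (h.spectral 0).isUnitMeanFunctional_eval s₁
  have h₂ := (h.spectral 0).isUnitMeanFunctional_eval s₂
  rw [MaxStable.concurrenceProb_pair]
  constructor
  · rw [measureReal_eq_zero_iff]
    exact h.hasPoissonLaplace.measure_concurrenceSet_eq_zero_iff h₁ h₂ hY hν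
  · rw [measureReal_def, ENNReal.toReal_eq_one_iff]
    exact h.hasPoissonLaplace.measure_concurrenceSet_eq_one_iff h₁ h₂ hY hν
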